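/- An $r$-graph is a finite hypergraph all of whose edges have exactly $r$ vertices, and an ordered $r$-graph is an $r$-graph with a linear order on its vertex set. A $d$-dimensional $r$-simplex is an $r$-graph with exactly $d+1$ edges such that any $d$ of the edges have a common vertex but all $d+1$ edges have no common vertex; $\mathcal S_d^r$ is the family of all of them. An ordered $r$-graph is interval $r$-partite if there are intervals $I_1<I_2<\dots<I_r$ of its vertex set such that every edge has exactly one vertex in each $I_i$. Let $\mathrm{ord}(\mathcal S_d^r)$ be the family of all interval $r$-partite ordered $r$-graphs that are isomorphic, as unordered $r$-graphs, to a member of $\mathcal S_d^r$. An ordered $r$-graph $H$ contains an ordered $r$-graph $F$ if there is a strictly increasing map from the vertices of $F$ to the vertices of $H$ that sends edges to edges. For an ordered $r$-graph $F$, let $\mathrm{ex}_{\to}(n,F)$ be the maximum number of edges in an $n$-vertex ordered $r$-graph that does not contain $F$, and for a family $\mathcal F$ of ordered $r$-graphs let $\mathrm{ex}_{\to}(n,\mathcal F)=\min_{F\in\mathcal F}\mathrm{ex}_{\to}(n,F)$. Theorem. For all fixed integers $r\ge d+1\ge 3$, $$\mathrm{ex}_{\to}(n,\mathrm{ord}(\mathcal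 S_d^r))=\Theta(n^{r-1})\qquad (n\to\infty).$$ The same holds for the maximum number of edges in an $n$-vertex ordered $r$-graph that contains no member of $\mathrm{ord}(\mathcal S_d^r)$. -/

import Mathlib

open Filter Asymptotics

/-- An `r`-graph on the vertex set `V`: a finite set of edges, each an `r`-subset of `V`. -/
structure RGraph (r : ℕ) (V : Type) where
  edges : Finset (Finset V)
  uniform : ∀ e ∈ edges, e.card = r

/-- Families of finite `r`-graphs. Every finite `r`-graph is isomorphic to one whose vertex set is
`Fin m` for some `m`, and every finite ordered `r`-graph is isomorphic, as an ordered `r`-graph,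
to exactly one whose vertex set is `Fin m` with its usual linear order. The same type therefore
serves for families of `r`-graphs (the order of `Fin m` is ignored) and for families of
ordered `r`-graphs (the order of `Fin m` is the vertex order). -/
abbrev RGraphFamily (r : ℕ) : Type := Set (Σ m : ℕ, RGraph r (Fin m))

namespace RGraph

/-- Isomorphism of (unordered) `r`-graphs. -/
def Isomorphic {r : ℕ} {V W : Type} (G : RGraph r V) (H : RGraph r W) : Prop :=
  ∃ φ : V ≃ W, ∀ e : Finset V, e ∈ G.edges ↔ e.map φ.toEmbedding ∈ H.edges

/-- An ordered `r`-graph is interval `r`-partite if there are intervals `I 0 < I 1 < ⋯ < I (r - 1)`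
of the vertex set such that every edge has exactly one vertex in each of them. -/
def IsIntervalPartite {r : ℕ} {V : Type} [LinearOrder V] (G : RGraph r V) : Prop :=
  ∃ I : Fin r → Set V,
    (∀ i, (I i).OrdConnected) ∧
    (∀ i j, i < j → ∀ a ∈ I i, ∀ b ∈ I j, a < b) ∧
    ∀ e ∈ G.edges, ∀ i, ∃! v, v ∈ e ∧ v ∈ I i

/-- The ordered `r`-graph `H` contains the ordered `r`-graph `F`: some strictly increasing map of
the vertices sends every edge of `F` to an edge of `H`. -/
def OrdContains {r : ℕ} {V W : Type} [LinearOrder V] [LinearOrder W]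
    (H : RGraph r W) (F : RGraph r V) : Prop :=
  ∃ φ : V ↪o W, ∀ e ∈ F.edges, e.map φ.toEmbedding ∈ H.edges

/-- `G` is a `d`-dimensional `r`-simplex: it has `d + 1` edges, any `d` of them have a common
vertex, and all `d + 1` of them have no common vertex. -/
def IsSimplex {r : ℕ} {V : Type} (d : ℕ) (G : RGraph r V) : Prop :=
  G.edges.card = d + 1 ∧
  (∀ A : Finset (Finset V), A ⊆ G.edges → A.card = d → ∃ v, ∀ e ∈ A, v ∈ e) ∧
  ¬ ∃ v, ∀ e ∈ G.edges, v ∈ e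

end RGraph

/-- The family `S_d^r` of `d`-dimensional `r`-simplices. -/
def simplexFamily (d r : ℕ) : RGraphFamily r := {G | G.2.IsSimplex d}

/-- `ord 𝓕`: the ordered `r`-graphs that are interval `r`-partite and isomorphic, as unordered
`r`-graphs, to a member of `𝓕`. -/
def ordFamily {r : ℕ} (𝓕 : RGraphFamily r) : RGraphFamily r :=
  {G | G.2.IsIntervalPartite ∧ ∃ F ∈ 𝓕, G.2.Isomorphic F.2}

/-- The maximum number of edges of an ordered `n`-vertex `r`-graph that does not contain the
ordered `r`-graph `F`. -/
noncomputable def exOrd {r m : ℕ} (n : ℕ) (F : RGraph r (Fin m)) : ℕ :=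
  sSup {k | ∃ H : RGraph r (Fin n), ¬ H.OrdContains F ∧ H.edges.card = k}

/-- The minimum of `exOrd n F` over the members `F` of the family `𝓕`. -/
noncomputable def exOrdMin {r : ℕ} (n : ℕ) (𝓕 : RGraphFamily r) : ℕ :=
  sInf {k | ∃ F ∈ 𝓕, exOrd n F.2 = k}

/-- The maximum number of edges of an ordered `n`-vertex `r`-graph that contains no member of the
family `𝓕`. -/
noncomputable def exOrdFree {r : ℕ} (n : ℕ) (𝓕 : RGraphFamily r) : ℕ :=
  sSup {k | ∃ H : RGraph r (Fin n), (∀ F ∈ 𝓕, ¬ H.OrdContains F.2) ∧ H.edges.card = k}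

/-! Lower bound: the star of all edges through one vertex is free of every `r`-graph that has edges
but no vertex common to all of them, hence of the whole family, and it has `(n - 1).choose (r - 1)`
edges.

Upper bound: one member of the family suffices. Colour the positions `0, …, r - 1` with all `d + 1`
colours, take vertices `x₀ < y₀ < x₁ < y₁ < ⋯`, and let edge `i` be the tuple `x` with `x j` raised
to `y j` at the positions of colour `i`. To find this `colourSimplex` in a host graph, read its
edges as increasing tuples. All but `S.card * n ^ (r - 1)` of them can be raised on a set `S` of
positions to another edge, each new entry staying below all later old ones (`card_not_interleaves`).
The colour classes partition the `r` positions, so more than `r * n ^ (r - 1)` edges leave a tuple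
that can be raised on every class; it and its raised versions span the copy. -/

/-! ### Interleaved tuples -/

/-- The tuple `y` agrees with `x` outside `S`, and on `S` every entry of `y` lies strictly above the
corresponding entry of `x` and strictly below all later entries of `x`. -/
def Interleaves {r n : ℕ} (S : Finset (Fin r)) (x y : Fin r → Fin n) : Prop :=
  (∀ j ∉ S, y j = x j) ∧ ∀ j ∈ S, x j < y j ∧ ∀ k, j < k → y j < x k

open Classical in
theorem card_not_interleaves_singleton {r n : ℕ} (A : Finset (Fin r → Fin n))
    (hA : ∀ x ∈ A, StrictMono x) (a : Fin r) :
    (A.filter fun x => ¬ ∃ y ∈ A, Interleaves {a} x y).card ≤ n ^ (r - 1) := by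
  have key : ∀ x ∈ A, ∀ y ∈ A, (∀ j, j ≠ a → x j = y j) → x a < y a → Interleaves {a} x y := by
    intro x _ y hy hxy hlt
    refine ⟨fun j hj => (hxy j (by simpa using hj)).symm, fun j hj => ?_⟩
    obtain rfl : j = a := by simpa using hj
    exact ⟨hlt, fun k hk => (hxy k hk.ne').symm ▸ hA y hy hk⟩
  -- An exceptional tuple has the largest `a`-entry among the members of `A` with the same other
  -- entries, so those `r - 1` entries determine it.
  have hinj : Set.InjOn (fun (x : Fin r → Fin n) (j : {j : Fin r // j ≠ a}) => x j)
      (A.filter fun x => ¬ ∃ y ∈ A, Interleaves {a} x y : Finset (Fin r → Fin n)) := by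
    intro x hx y hy hxy
    simp only [Finset.coe_filter, Set.mem_ofPred_eq] at hx hy
    have h : ∀ j, j ≠ a → x j = y j := fun j hj => congrFun hxy ⟨j, hj⟩
    have hxa : x a = y a := by
      rcases lt_trichotomy (x a) (y a) with h' | h' | h'
      · exact absurd ⟨y, hy.1, key x hx.1 y hy.1 h h'⟩ hx.2
      · exact h'
      · exact absurd ⟨x, hx.1, key y hy.1 x hx.1 (fun j hj => (h j hj).symm) h'⟩ hy.2
    funext j
    by_cases hj : j = a
    · exact hj ▸ hxa
    · exact h j hj
  calc _ ≤ (Finset.univ : Finset ({j : Fin r // j ≠ a} → Fin n)).card :=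
        Finset.card_le_card_of_injOn _ (fun _ _ => Finset.mem_coe.2 (Finset.mem_univ _)) hinj
    _ = n ^ (r - 1) := by simp [Fintype.card_subtype_compl]

open Classical in
/-- All but few members of a set of increasing tuples are interleaved, on a given set of
coordinates, by a member of the set. -/
theorem card_not_interleaves {r n : ℕ} (A : Finset (Fin r → Fin n))
    (hA : ∀ x ∈ A, StrictMono x) (S : Finset (Fin r)) :
    (A.filter fun x => ¬ ∃ y ∈ A, Interleaves S x y).card ≤ S.card * n ^ (r - 1) := by
  induction S using Finset.induction_on_min with
  | empty =>
    have : (A.filter fun x => ¬ ∃ y ∈ A, Interleaves ∅ x y) = ∅ :=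
      Finset.filter_eq_empty_iff.2 fun x hx h => h ⟨x, hx, by simp [Interleaves]⟩
    rw [this, Finset.card_empty]
    exact Nat.zero_le _
  | insert a s has ih =>
    have ha : a ∉ s := fun h => lt_irrefl _ (has a h)
    let B := A.filter fun x => ∃ y ∈ A, Interleaves s x y
    -- Raise `x` at `a` to some `z ∈ B`, then `z` on `s` to `y`. As `a` lies below all of `s`, the
    -- bounds at positions of `s` involve only entries in which `z` and `x` agree.
    have hsub : (A.filter fun x => ¬ ∃ y ∈ A, Interleaves (insert a s) x y) ⊆
        (A.filter fun x => ¬ ∃ y ∈ A, Interleaves s x y) ∪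
          (B.filter fun x => ¬ ∃ y ∈ B, Interleaves {a} x y) := by
      intro x hx
      rw [Finset.mem_filter] at hx
      by_contra hcon
      simp only [Finset.mem_union, Finset.mem_filter, not_or, not_and, not_not, B] at hcon
      obtain ⟨z, ⟨-, y, hy, hzy⟩, hxz⟩ := hcon.2 ⟨hx.1, hcon.1 hx.1⟩
      have hz : ∀ j, j ≠ a → z j = x j := fun j hj => hxz.1 j (by simpa using hj)
      refine hx.2 ⟨y, hy, fun j hj => ?_, fun j hj => ?_⟩
      · rw [Finset.mem_insert, not_or] at hj
        rw [hzy.1 j hj.2, hz j hj.1]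
      · rcases Finset.mem_insert.1 hj with rfl | hj
        · rw [hzy.1 j ha]
          exact hxz.2 j (by simp)
        · have hja := has j hj
          rw [← hz j hja.ne']
          refine ⟨(hzy.2 j hj).1, fun k hk => ?_⟩
          rw [← hz k (hja.trans hk).ne']
          exact (hzy.2 j hj).2 k hk
    have hB := card_not_interleaves_singleton B (fun x hx => hA x (Finset.mem_filter.1 hx).1) a
    calc _ ≤ _ := (Finset.card_le_card hsub).trans (Finset.card_union_le _ _)
      _ ≤ s.card * n ^ (r - 1) + n ^ (r - 1) := add_le_add ih hB
      _ = _ := by rw [Finset.card_insert_of_notMem ha]; ring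

open Classical in
/-- If a set of increasing tuples is large, some tuple is interleaved on every colour class of a
colouring of the coordinates. -/
theorem exists_forall_interleaves {r n d : ℕ} (c : Fin r → Fin d) (A : Finset (Fin r → Fin n))
    (hA : ∀ x ∈ A, StrictMono x) (hcard : r * n ^ (r - 1) < A.card) :
    ∃ x ∈ A, ∀ i, ∃ y ∈ A, Interleaves (Finset.univ.filter fun j => c j = i) x y := by
  by_contra! hcon
  have hsub : A ⊆ Finset.univ.biUnion fun i : Fin d =>
      A.filter fun x => ¬ ∃ y ∈ A, Interleaves (Finset.univ.filter fun j => c j = i) x y := by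
    intro x hx
    obtain ⟨i, hi⟩ := hcon x hx
    simp only [Finset.mem_biUnion, Finset.mem_univ, true_and, Finset.mem_filter]
    exact ⟨i, hx, fun ⟨y, hy, h⟩ => hi y hy h⟩
  refine hcard.not_ge ((Finset.card_le_card hsub).trans (Finset.card_biUnion_le.trans
    ((Finset.sum_le_sum fun i _ => card_not_interleaves A hA _).trans ?_)))
  -- The colour classes partition the coordinates, so their sizes add up to `r`.
  rw [← Finset.sum_mul]
  refine Nat.mul_le_mul_right _ (le_of_eq ?_)
  simpa using (Finset.card_eq_sum_card_fiberwise
    (f := c) (s := Finset.univ) (t := Finset.univ) (fun _ _ => by simp)).symm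

/-! ### The simplex given by a colouring -/

/-- The vertices `2j` and `2j + 1`, according to the truth of `p`. -/
def pairVertex {r : ℕ} (j : Fin r) (p : Prop) [Decidable p] : Fin (2 * r) :=
  ⟨2 * j + if p then 1 else 0, by split_ifs <;> omega⟩

theorem pairVertex_inj {r : ℕ} {j k : Fin r} {p q : Prop} [Decidable p] [Decidable q] :
    pairVertex j p = pairVertex k q ↔ j = k ∧ (p ↔ q) := by
  simp only [pairVertex, Fin.ext_iff]
  by_cases hp : p <;> by_cases hq : q <;> simp [hp, hq] <;> omega

theorem exists_eq_pairVertex {r : ℕ} (v : Fin (2 * r)) :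
    ∃ j : Fin r, v = pairVertex j (v.1 % 2 = 1) := by
  refine ⟨⟨v / 2, by omega⟩, ?_⟩
  simp only [pairVertex, Fin.ext_iff]
  split_ifs <;> omega

/-- The edge of `colourSimplex c` with index `i`. -/
def colourEdge {r d : ℕ} (c : Fin r → Fin d) (i : Fin d) : Finset (Fin (2 * r)) :=
  Finset.univ.image fun j => pairVertex j (c j = i)

theorem pairVertex_mem_colourEdge {r d : ℕ} {c : Fin r → Fin d} {i : Fin d} {j : Fin r}
    {p : Prop} [Decidable p] : pairVertex j p ∈ colourEdge c i ↔ (c j = i ↔ p) := by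
  simp only [colourEdge, Finset.mem_image, Finset.mem_univ, true_and, pairVertex_inj]
  constructor
  · rintro ⟨k, rfl, h⟩
    exact h
  · exact fun h => ⟨j, rfl, h⟩

/-- The ordered `r`-graph on the vertices `x₀ < y₀ < x₁ < y₁ < ⋯` with one edge for each colour `i`,
which consists of the `y j` with `c j = i` and the `x j` with `c j ≠ i`. -/
def colourSimplex {r d : ℕ} (c : Fin r → Fin d) : RGraph r (Fin (2 * r)) where
  edges := Finset.univ.image (colourEdge c)
  uniform := by
    intro e he
    obtain ⟨i, -, rfl⟩ := Finset.mem_image.1 he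
    rw [colourEdge, Finset.card_image_of_injective _ fun j k h => (pairVertex_inj.1 h).1]
    simp

theorem mem_colourSimplex {r d : ℕ} {c : Fin r → Fin d} {e : Finset (Fin (2 * r))} :
    e ∈ (colourSimplex c).edges ↔ ∃ i, colourEdge c i = e := by
  simp [colourSimplex]

theorem colourEdge_injective {r d : ℕ} {c : Fin r → Fin d} (hc : Function.Surjective c) :
    Function.Injective (colourEdge c) := by
  intro i k h
  obtain ⟨j, rfl⟩ := hc i
  have : pairVertex j True ∈ colourEdge c (c j) := pairVertex_mem_colourEdge.2 (by simp)
  rw [h, pairVertex_mem_colourEdge] at this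
  exact this.2 trivial

theorem colourSimplex_isIntervalPartite {r d : ℕ} (c : Fin r → Fin d) :
    (colourSimplex c).IsIntervalPartite := by
  refine ⟨fun j => {v | v.1 / 2 = j.1}, fun j => ⟨?_⟩, ?_, ?_⟩
  · intro a ha b hb v hv
    simp only [Set.mem_ofPred_eq, Set.mem_Icc, Fin.le_def] at *
    omega
  · intro i j hij a ha b hb
    simp only [Set.mem_ofPred_eq, Fin.lt_def] at *
    omega
  · intro e he j
    obtain ⟨i, rfl⟩ := mem_colourSimplex.1 he
    have hdiv : ∀ (k : Fin r) (p : Prop) [Decidable p], (pairVertex k p).1 / 2 = k.1 := by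
      intro k p _
      simp only [pairVertex]
      split_ifs <;> omega
    refine ⟨pairVertex j (c j = i), ⟨pairVertex_mem_colourEdge.2 Iff.rfl, hdiv _ _⟩, ?_⟩
    rintro v ⟨hv, hvj⟩
    obtain ⟨k, -, rfl⟩ := Finset.mem_image.1 hv
    obtain rfl : k = j := Fin.ext ((hdiv _ _).symm.trans hvj)
    rfl

/-- If edge `i` is left out, the lower vertex of any pair of colour `i` lies in all the others. No
vertex lies in every edge: a lower vertex misses the edge of its own colour, and an upper vertex
lies in that edge only, while there are at least two colours. -/
theorem colourSimplex_isSimplex {r d : ℕ} (hd : 1 ≤ d) {c : Fin r → Fin (d + 1)}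
    (hc : Function.Surjective c) : (colourSimplex c).IsSimplex d := by
  have hcard : (colourSimplex c).edges.card = d + 1 := by
    rw [colourSimplex, Finset.card_image_of_injective _ (colourEdge_injective hc)]
    simp
  refine ⟨hcard, fun A hA hAd => ?_, ?_⟩
  · obtain ⟨e, he, heA⟩ : ∃ e ∈ (colourSimplex c).edges, e ∉ A :=
      Finset.exists_mem_notMem_of_card_lt_card (by omega)
    obtain ⟨i, rfl⟩ := mem_colourSimplex.1 he
    obtain ⟨j, rfl⟩ := hc i
    refine ⟨pairVertex j False, fun e' he' => ?_⟩
    obtain ⟨k, rfl⟩ := mem_colourSimplex.1 (hA he')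
    rw [pairVertex_mem_colourEdge, iff_false]
    rintro rfl
    exact heA he'
  · rintro ⟨v, hv⟩
    obtain ⟨j, hj⟩ := exists_eq_pairVertex v
    have h : ∀ i, c j = i ↔ v.1 % 2 = 1 := fun i => by
      have := hv _ (mem_colourSimplex.2 ⟨i, rfl⟩)
      rw [hj] at this
      exact pairVertex_mem_colourEdge.1 this
    have : Nontrivial (Fin (d + 1)) := Fin.nontrivial_iff_two_le.2 (by omega)
    obtain ⟨i, hi⟩ := exists_ne (c j)
    exact hi ((h i).2 ((h _).1 rfl)).symm

theorem colourSimplex_mem_ordFamily {r d : ℕ} (hd : 1 ≤ d) {c : Fin r → Fin (d + 1)}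
    (hc : Function.Surjective c) :
    (⟨2 * r, colourSimplex c⟩ : Σ m : ℕ, RGraph r (Fin m)) ∈ ordFamily (simplexFamily d r) :=
  ⟨colourSimplex_isIntervalPartite c, ⟨2 * r, colourSimplex c⟩, colourSimplex_isSimplex hd hc,
    Equiv.refl _, fun e => by simp⟩

/-! ### Embedding the simplex in a dense ordered `r`-graph -/

/-- An ordered `r`-graph with more than `r * n ^ (r - 1)` edges contains every `colourSimplex`. -/
theorem ordContains_colourSimplex {r n d : ℕ} (c : Fin r → Fin d) (H : RGraph r (Fin n))
    (hH : r * n ^ (r - 1) < H.edges.card) : H.OrdContains (colourSimplex c) := by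
  classical
  let A : Finset (Fin r → Fin n) :=
    Finset.univ.filter fun x => StrictMono x ∧ Finset.univ.image x ∈ H.edges
  have hA : ∀ x ∈ A, StrictMono x := fun x hx => (Finset.mem_filter.1 hx).2.1
  have hsub : H.edges ⊆ A.image fun x => Finset.univ.image x := by
    intro e he
    have him : Finset.univ.image (e.orderEmbOfFin (H.uniform e he)) = e :=
      Finset.image_orderEmbOfFin_univ _ _
    refine Finset.mem_image.2 ⟨e.orderEmbOfFin (H.uniform e he), Finset.mem_filter.2
      ⟨Finset.mem_univ _, (e.orderEmbOfFin _).strictMono, ?_⟩, him⟩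
    rwa [him]
  obtain ⟨x, hx, hxy⟩ := exists_forall_interleaves c A hA
    (hH.trans_le ((Finset.card_le_card hsub).trans Finset.card_image_le))
  choose y hyA hy using hxy
  -- Each position takes its upper vertex from the raised tuple of its own colour, the only one that
  -- differs from `x` there.
  have hlt : ∀ j, x j < y (c j) j ∧ ∀ k, j < k → y (c j) j < x k :=
    fun j => (hy (c j)).2 j (by simp)
  let f : Fin (2 * r) → Fin n := fun v =>
    if v.1 % 2 = 1 then y (c ⟨v / 2, by omega⟩) ⟨v / 2, by omega⟩ else x ⟨v / 2, by omega⟩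
  have hf : ∀ (j : Fin r) (p : Prop) [Decidable p],
      f (pairVertex j p) = if p then y (c j) j else x j := by
    intro j p _
    by_cases hp : p
    · have h2 : (2 * j.1 + 1) / 2 = j.1 := by omega
      simp [f, pairVertex, hp, h2, Nat.add_mod]
    · simp [f, pairVertex, hp]
  have hmono : StrictMono f := by
    intro a b hab
    obtain ⟨j, hj⟩ := exists_eq_pairVertex a
    obtain ⟨k, hk⟩ := exists_eq_pairVertex b
    have hjk : j < k ∨ j = k ∧ ¬ a.1 % 2 = 1 ∧ b.1 % 2 = 1 := by
      have h1 := congrArg Fin.val hj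
      have h2 := congrArg Fin.val hk
      simp only [pairVertex] at h1 h2
      rw [Fin.lt_def] at hab ⊢
      rw [Fin.ext_iff]
      split_ifs at h1 h2 <;> omega
    rw [hj, hk, hf, hf]
    rcases hjk with hjk | ⟨rfl, ha, hb⟩
    · have h1 : (if a.1 % 2 = 1 then y (c j) j else x j) < x k := by
        split_ifs
        exacts [(hlt j).2 k hjk, hA x hx hjk]
      refine h1.trans_le ?_
      split_ifs
      exacts [(hlt k).1.le, le_rfl]
    · rw [if_neg ha, if_pos hb]
      exact (hlt j).1
  refine ⟨OrderEmbedding.ofStrictMono f hmono, fun e he => ?_⟩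
  obtain ⟨i, rfl⟩ := mem_colourSimplex.1 he
  -- Off colour `i` the tuple `y i` agrees with `x`, so the image of edge `i` is exactly the edge of
  -- `H` given by `y i`.
  have himage : (colourEdge c i).map (OrderEmbedding.ofStrictMono f hmono).toEmbedding =
      Finset.univ.image (y i) := by
    rw [Finset.map_eq_image, colourEdge, Finset.image_image]
    refine Finset.image_congr fun j _ => ?_
    change f (pairVertex j (c j = i)) = y i j
    rw [hf]
    split_ifs with h
    · rw [h]
    · exact ((hy i).1 j (by simpa using h)).symm
  rw [himage]
  exact (Finset.mem_filter.1 (hyA i)).2.2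

theorem bddAbove_edges_card {r n : ℕ} (P : RGraph r (Fin n) → Prop) :
    BddAbove {k | ∃ H : RGraph r (Fin n), P H ∧ H.edges.card = k} :=
  ⟨Fintype.card (Finset (Fin n)), by rintro k ⟨H, -, rfl⟩; exact Finset.card_le_univ _⟩

/-! ### The star and the lower bound -/

/-- The `r`-graph of all edges that contain the vertex `v`. -/
def starGraph {V : Type} [Fintype V] [DecidableEq V] (r : ℕ) (hr : 1 ≤ r) (v : V) :
    RGraph r V where
  edges := ((Finset.univ.erase v).powersetCard (r - 1)).image (insert v)
  uniform := by
    intro e he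
    obtain ⟨s, hs, rfl⟩ := Finset.mem_image.1 he
    rw [Finset.mem_powersetCard] at hs
    rw [Finset.card_insert_of_notMem fun h => Finset.notMem_erase _ _ (hs.1 h), hs.2]
    omega

theorem card_starGraph_edges {V : Type} [Fintype V] [DecidableEq V] (r : ℕ) (hr : 1 ≤ r) (v : V) :
    (starGraph r hr v).edges.card = (Fintype.card V - 1).choose (r - 1) := by
  rw [starGraph, Finset.card_image_of_injOn, Finset.card_powersetCard,
    Finset.card_erase_of_mem (Finset.mem_univ _), Finset.card_univ]
  intro s hs t ht hst
  have h : ∀ u : Finset V, u ∈ (Finset.univ.erase v).powersetCard (r - 1) → v ∉ u :=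
    fun u hu hv => Finset.notMem_erase _ _ ((Finset.mem_powersetCard.1 hu).1 hv)
  rw [← Finset.erase_insert (h s hs), ← Finset.erase_insert (h t ht)]
  exact congrArg (fun u => Finset.erase u v) hst

/-- In a copy of `F`, every edge has a vertex mapped to `v`; by injectivity this is always the same
vertex, which would be common to all edges of `F`. -/
theorem not_ordContains_starGraph {r n m : ℕ} (hr : 1 ≤ r) (v : Fin n) {F : RGraph r (Fin m)}
    (hF : F.edges.Nonempty) (hF' : ¬ ∃ w, ∀ e ∈ F.edges, w ∈ e) :
    ¬ (starGraph r hr v).OrdContains F := by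
  rintro ⟨φ, hφ⟩
  have hv : ∀ e ∈ F.edges, ∃ w ∈ e, φ w = v := by
    intro e he
    obtain ⟨s, -, hs⟩ := Finset.mem_image.1 (hφ e he)
    have : v ∈ e.map φ.toEmbedding := hs ▸ Finset.mem_insert_self _ _
    simpa using this
  obtain ⟨e₀, he₀⟩ := hF
  obtain ⟨w, -, hw⟩ := hv e₀ he₀
  refine hF' ⟨w, fun e he => ?_⟩
  obtain ⟨w', hw', h⟩ := hv e he
  rwa [φ.injective (hw.trans h.symm)]

theorem RGraph.Isomorphic.exists_common_vertex {r : ℕ} {V W : Type} {G : RGraph r V}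
    {H : RGraph r W} (h : G.Isomorphic H) (hG : ∃ v, ∀ e ∈ G.edges, v ∈ e) :
    ∃ w, ∀ e ∈ H.edges, w ∈ e := by
  obtain ⟨φ, hφ⟩ := h
  obtain ⟨v, hv⟩ := hG
  refine ⟨φ v, fun e he => ?_⟩
  have := hv (e.map φ.symm.toEmbedding) ((hφ _).2 (by simpa [Finset.map_map] using he))
  simpa [Finset.mem_map, Equiv.symm_apply_eq] using this

theorem RGraph.Isomorphic.edges_nonempty {r : ℕ} {V W : Type} {G : RGraph r V} {H : RGraph r W}
    (h : G.Isomorphic H) (hH : H.edges.Nonempty) : G.edges.Nonempty := by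
  obtain ⟨φ, hφ⟩ := h
  obtain ⟨e, he⟩ := hH
  exact ⟨e.map φ.symm.toEmbedding, (hφ _).2 (by simpa [Finset.map_map] using he)⟩

theorem not_ordContains_starGraph_of_mem_ordFamily {r d n : ℕ} (hr : 1 ≤ r) (v : Fin n)
    {F : Σ m : ℕ, RGraph r (Fin m)} (hF : F ∈ ordFamily (simplexFamily d r)) :
    ¬ (starGraph r hr v).OrdContains F.2 := by
  obtain ⟨-, G, hG, hiso⟩ := hF
  refine not_ordContains_starGraph hr v (hiso.edges_nonempty ?_)
    fun h => hG.2.2 (hiso.exists_common_vertex h)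
  exact Finset.card_pos.1 (hG.1 ▸ Nat.succ_pos d)

/-! ### Asymptotics and conclusion -/

theorem exists_pow_le_choose (k : ℕ) :
    ∃ C : ℝ, ∀ᶠ n : ℕ in atTop, (n : ℝ) ^ k ≤ C * ((n - 1).choose k : ℝ) := by
  -- For `n ≥ 2 * k + 1` one has `n ≤ 2 * (n - k)`, and each of the `k` factors of the falling
  -- factorial of `n - 1` is at least `n - k`.
  refine ⟨2 ^ k * (k.factorial : ℝ), eventually_atTop.2 ⟨2 * k + 1, fun n hn => ?_⟩⟩
  have h1 : n ^ k ≤ 2 ^ k * (n - 1 + 1 - k) ^ k := by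
    rw [← mul_pow]
    exact Nat.pow_le_pow_left (by omega) k
  have h2 : (n - 1 + 1 - k) ^ k ≤ k.factorial * (n - 1).choose k :=
    (Nat.pow_sub_le_descFactorial (n - 1) k).trans_eq (Nat.descFactorial_eq_factorial_mul_choose _ _)
  have h3 := h1.trans (Nat.mul_le_mul_left (2 ^ k) h2)
  rw [mul_assoc]
  exact_mod_cast h3

theorem isTheta_pow_of_choose_le {k C : ℕ} {f : ℕ → ℕ} (hlow : ∀ n, 1 ≤ n → (n - 1).choose k ≤ f n)
    (hup : ∀ n, f n ≤ C * n ^ k) :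
    (fun n : ℕ => (f n : ℝ)) =Θ[atTop] fun n : ℕ => (n : ℝ) ^ k := by
  constructor
  · refine IsBigO.of_bound C (Eventually.of_forall fun n => ?_)
    rw [Real.norm_of_nonneg (by positivity), Real.norm_of_nonneg (by positivity)]
    exact_mod_cast hup n
  · obtain ⟨D, hD⟩ := exists_pow_le_choose k
    refine IsBigO.of_bound |D| ?_
    filter_upwards [hD, eventually_ge_atTop 1] with n hn hn1
    rw [Real.norm_of_nonneg (by positivity), Real.norm_of_nonneg (by positivity)]
    have h : ((n - 1).choose k : ℝ) ≤ f n := by exact_mod_cast hlow n hn1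
    exact hn.trans (mul_le_mul (le_abs_self D) h (by positivity) (abs_nonneg D))

theorem mainTheorem3 (r d : ℕ) (hd : 3 ≤ d + 1) (hr : d + 1 ≤ r) :
    ((fun n : ℕ => (exOrdMin n (ordFamily (simplexFamily d r)) : ℝ))
        =Θ[atTop] fun n : ℕ => (n : ℝ) ^ (r - 1)) ∧
    ((fun n : ℕ => (exOrdFree n (ordFamily (simplexFamily d r)) : ℝ))
        =Θ[atTop] fun n : ℕ => (n : ℝ) ^ (r - 1)) := by
  have hr1 : 1 ≤ r := by omega
  -- Any surjective colouring would do; one exists because `d + 1 ≤ r`.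
  let c : Fin r → Fin (d + 1) := fun j => ⟨min j d, by omega⟩
  have hc : Function.Surjective c := fun i =>
    ⟨⟨i, by omega⟩, Fin.ext (min_eq_left (Nat.lt_succ_iff.1 i.2))⟩
  have hmem := colourSimplex_mem_ordFamily (d := d) (by omega) hc
  have hup : ∀ n (H : RGraph r (Fin n)), ¬ H.OrdContains (colourSimplex c) →
      H.edges.card ≤ r * n ^ (r - 1) :=
    fun n H h => not_lt.1 fun hlt => h (ordContains_colourSimplex c H hlt)
  have hstar : ∀ n (hn : 1 ≤ n),
      (starGraph r hr1 (⟨0, hn⟩ : Fin n)).edges.card = (n - 1).choose (r - 1) := by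
    intro n hn
    rw [card_starGraph_edges, Fintype.card_fin]
  refine ⟨isTheta_pow_of_choose_le (C := r) (fun n hn => ?_) (fun n => ?_),
    isTheta_pow_of_choose_le (C := r) (fun n hn => ?_) (fun n => ?_)⟩
  · refine le_csInf ⟨exOrd n (colourSimplex c), ⟨_, hmem, rfl⟩⟩ ?_
    rintro _ ⟨F, hF, rfl⟩
    exact le_csSup (bddAbove_edges_card _)
      ⟨_, not_ordContains_starGraph_of_mem_ordFamily hr1 ⟨0, hn⟩ hF, hstar n hn⟩
  · have hle : exOrdMin n (ordFamily (simplexFamily d r)) ≤ exOrd n (colourSimplex c) :=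
      Nat.sInf_le ⟨_, hmem, rfl⟩
    refine hle.trans (csSup_le' ?_)
    rintro _ ⟨H, hH, rfl⟩
    exact hup n H hH
  · exact le_csSup (bddAbove_edges_card _)
      ⟨_, fun F hF => not_ordContains_starGraph_of_mem_ordFamily hr1 ⟨0, hn⟩ hF, hstar n hn⟩
  · refine csSup_le' ?_
    rintro _ ⟨H, hH, rfl⟩
    exact hup n H (hH _ hmem)
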